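/- Let $M$ be a finite-dimensional smooth Riemannian manifold without boundary, with metric $\langle\cdot,\cdot\rangle$, norm $\|\cdot\|$ and Levi-Civita connection $\nabla$. Let $\mathcal M=\mathrm{Imm}([0,1],M)$ be the space of smooth curves $c:[0,1]\to M$ with $c'(t)\neq 0$ for all $t\in[0,1]$. The tangent space $T_c\mathcal M$ is the space of smooth vector fields along $c$, and for $h\in T_c\mathcal M$, seen as a smooth curve in $TM$, the tangent space $T_hT\mathcal M$ is the space of smooth vector fields $\xi$ along $h$, $\xi(t)\in T_{h(t)}TM$. For $c\in\mathcal M$ and $h,k\in T_c\mathcal M$ put $$G_c(h,k)=\langle h(0),k(0)\rangle+\int_0^1\Big(\langle\nabla_\ell h^N,\nabla_\ell k^N\rangle+\tfrac14\langle\nabla_\ell h^T,\nabla_\ell k^T\rangle\Big)\,\|c'(t)\|\,dt,$$ where $\nabla_\ell h=\frac1{\|c'\|}\nabla_{c'}h$, $v=c'/\|c'\|$, $\nabla_\ell h^T=\langle\nabla_\ell h,v\rangle v$ and $\nabla_\ell h^N=\nabla_\ell h-\nabla_\ell h^T$. For $\xi\in T_{(p,u)}TM$, the velocity at time $0$ of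 a curve $s\mapsto(x(s),U(s))$ in $TM$ with $(x(0),U(0))=(p,u)$, let $\xi_H=x'(0)\in T_pM$ and $\xi_V=(\nabla_{x'}U)(0)\in T_pM$ be its horizontal and vertical projections. For $h\in T\mathcal M$ and $\xi,\eta\in T_hT\mathcal M$ put $$\tilde G_h(\xi,\eta)=\langle\xi(0)_H,\eta(0)_H\rangle+\int_0^1\langle\xi(t)_V,\eta(t)_V\rangle\,dt.$$ Let $R:\mathcal M\to T\mathcal M$, $R(c)=c'/\sqrt{\|c'\|}\in T_c\mathcal M$, be the square root velocity function. Its differential at $c$ sends $h\in T_c\mathcal M$ to $T_cR(h)\in T_{R(c)}T\mathcal M$, $T_cR(h)(t)=\partial_s|_{s=0}R(\gamma(s,\cdot))(t)$, where $\gamma(s,\cdot)\in\mathcal M$, $|s|<\varepsilon$, is any path such that $(s,t)\mapsto\gamma(s,t)$ is smooth, $\gamma(0,\cdot)=c$ and $\partial_s\gamma(0,\cdot)=h$. Then for all $c\in\mathcal M$ and $h\in T_c\mathcal M$ such a path exists and $T_cR(h)$ is a well-defined element of $T_{R(c)}T\mathcal M$, independent of the path, and $G$ is the pullback of $\tilde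 G$ by $R$: $$G_c(h,k)=\tilde G_{R(c)}\big(T_cR(h),T_cR(k)\big)\qquad\text{for all }c\in\mathcal M,\ h,k\in T_c\mathcal M.$$ -/

import Mathlib

open Bundle Manifold MeasureTheory
open scoped ContDiff

noncomputable section

namespace SRV

section Connection

variable {E : Type*} [NormedAddCommGroup E] [NormedSpace ℝ E] [FiniteDimensional ℝ E]
  {H : Type*} [TopologicalSpace H] (I : ModelWithCorners ℝ E H)
  {M : Type*} [TopologicalSpace M] [ChartedSpace H M] [IsManifold I ∞ M]
  [RiemannianBundle (fun x : M => TangentSpace I x)]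

/-- The Gram form of the Riemannian metric at `x`, in the coordinates of the chart at `p`:
`(v, w) ↦ ∑ i j, g i j (x) * v i * w j`. Only its values for `x` near `p` are used. -/
def metricInChart (p x : M) : E →L[ℝ] E →L[ℝ] ℝ :=
  (innerSL ℝ : TangentSpace I x →L[ℝ] TangentSpace I x →L[ℝ] ℝ).bilinearComp
    ((trivializationAt E (TangentSpace I) p).symmL ℝ x)
    ((trivializationAt E (TangentSpace I) p).symmL ℝ x)

/-- The Christoffel symbols at `p` of the Levi-Civita connection in the chart at `p`: the vector
`Γ(v, w) = ∑ i j k, Γ^k_ij v i w j ∂_k` is determined by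
`⟨Γ(v, w), z⟩ = (∂_v g(w, z) + ∂_w g(v, z) - ∂_z g(v, w)) / 2` for all `z`. -/
def christoffel (p : M) (v w : TangentSpace I p) : TangentSpace I p :=
  letI e : TangentSpace I p →L[ℝ] E :=
    (trivializationAt E (TangentSpace I) p).continuousLinearMapAt ℝ p
  letI D : TangentSpace I p →L[ℝ] E →L[ℝ] E →L[ℝ] ℝ :=
    mfderiv I 𝓘(ℝ, E →L[ℝ] E →L[ℝ] ℝ) (metricInChart I p) p
  haveI : FiniteDimensional ℝ (TangentSpace I p) := inferInstanceAs (FiniteDimensional ℝ E)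
  haveI : CompleteSpace (TangentSpace I p) := FiniteDimensional.complete ℝ _
  (InnerProductSpace.toDual ℝ (TangentSpace I p)).symm
    ((1 / 2 : ℝ) • ((D v (e w)) ∘L e + (D w (e v)) ∘L e - (D.flip (e v)).flip (e w)))

/-- The formula that determines the Christoffel symbols. -/
lemma inner_christoffel (p : M) (v w z : TangentSpace I p) :
    letI e : TangentSpace I p →L[ℝ] E :=
      (trivializationAt E (TangentSpace I) p).continuousLinearMapAt ℝ p
    letI D : TangentSpace I p →L[ℝ] E →L[ℝ] E →L[ℝ] ℝ :=
      mfderiv I 𝓘(ℝ, E →L[ℝ] E →L[ℝ] ℝ) (metricInChart I p) p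
    inner ℝ (christoffel I p v w) z =
      (D v (e w) (e z) + D w (e v) (e z) - D z (e v) (e w)) / 2 := by
  have : FiniteDimensional ℝ (TangentSpace I p) := inferInstanceAs (FiniteDimensional ℝ E)
  have : CompleteSpace (TangentSpace I p) := FiniteDimensional.complete ℝ _
  unfold christoffel
  rw [InnerProductSpace.toDual_symm_apply]
  have key : ∀ a : ℝ, (1 / 2 : ℝ) * a = a / 2 := fun a => by ring
  exact key _

variable {I}

/-- The horizontal projection `T_(p,u) TM → T_p M`, the differential of `TM → M`. -/
def hp {u : TangentBundle I M} (ξ : TangentSpace I.tangent u) : TangentSpace I u.proj :=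
  mfderiv I.tangent I (TotalSpace.proj : TangentBundle I M → M) u ξ

/-- The vertical projection `T_(p,u) TM → T_p M` of the Levi-Civita connection. If `ξ` is the
velocity at time `0` of a curve `(x, U)` in `TM`, then in the chart at `p = x 0` this is
`(dU/dt)(0) + Γ(x'(0), U(0))`, the covariant derivative of `U` along `x` at time `0`. -/
def vp {u : TangentBundle I M} (ξ : TangentSpace I.tangent u) : TangentSpace I u.proj :=
  (trivializationAt E (TangentSpace I) u.proj).symmL ℝ u.proj
      (mfderiv I.tangent 𝓘(ℝ, E)
        (fun w : TangentBundle I M => (trivializationAt E (TangentSpace I) u.proj w).2) u ξ)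
    + christoffel I u.proj (hp ξ) u.snd

/-- The vertical projection of the velocity of a curve `U` in `TM` is the covariant derivative of
`U` along its base curve: the derivative of the components plus the Christoffel term. -/
lemma vp_velocity {U : ℝ → TangentBundle I M} {s : ℝ}
    (hU : MDifferentiableAt 𝓘(ℝ, ℝ) I.tangent U s) :
    vp (u := U s) (mfderiv 𝓘(ℝ, ℝ) I.tangent U s (1 : ℝ)) =
      (trivializationAt E (TangentSpace I) (U s).proj).symmL ℝ (U s).proj
        (deriv (fun r => (trivializationAt E (TangentSpace I) (U s).proj (U r)).2) s)
      + christoffel I (U s).proj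
          (mfderiv 𝓘(ℝ, ℝ) I (fun r => (U r).proj) s (1 : ℝ)) (U s).snd := by
  have h1 : MDifferentiableAt I.tangent I (TotalSpace.proj : TangentBundle I M → M) (U s) :=
    (Bundle.contMDiff_proj (n := 1) (TangentSpace I : M → Type _)).mdifferentiableAt one_ne_zero
  have h2 : MDifferentiableAt I.tangent 𝓘(ℝ, E) (fun w : TangentBundle I M =>
      (trivializationAt E (TangentSpace I) (U s).proj w).2) (U s) :=
    (Bundle.contMDiffAt_totalSpace.1 (contMDiffAt_id (n := 1) (I := I.tangent)
      (x := U s))).2.mdifferentiableAt one_ne_zero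
  have e1 : hp (u := U s) (mfderiv 𝓘(ℝ, ℝ) I.tangent U s (1 : ℝ))
      = mfderiv 𝓘(ℝ, ℝ) I (fun r => (U r).proj) s (1 : ℝ) :=
    (DFunLike.congr_fun (mfderiv_comp s h1 hU) (1 : ℝ)).symm
  have e2 := DFunLike.congr_fun (mfderiv_comp s h2 hU) (1 : ℝ)
  rw [mfderiv_eq_fderiv] at e2
  unfold vp
  rw [e1]
  congr 2
  exact e2.symm

end Connection

section Curves

variable {E : Type*} [NormedAddCommGroup E] [NormedSpace ℝ E]
  {H : Type*} [TopologicalSpace H] (I : ModelWithCorners ℝ E H)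
  (M : Type*) [TopologicalSpace M] [ChartedSpace H M] [IsManifold I ∞ M]

/-- The space of smooth immersions `c : [0,1] → M`. -/
structure Imm where
  toFun : unitInterval → M
  smooth : ContMDiff (𝓡∂ 1) I ∞ toFun
  immersive : ∀ t, mfderiv (𝓡∂ 1) I toFun t 1 ≠ 0

instance : CoeFun (Imm I M) (fun _ => unitInterval → M) := ⟨Imm.toFun⟩

variable {I M}

/-- The velocity `c'(t)`. -/
def Imm.vel (c : Imm I M) (t : unitInterval) : TangentSpace I (c t) :=
  mfderiv (𝓡∂ 1) I c t 1

/-- The tangent space to the space of immersions at `c`: smooth vector fields along `c`. -/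
structure TImm (c : Imm I M) where
  toFun : ∀ t : unitInterval, TangentSpace I (c t)
  smooth : ContMDiff (𝓡∂ 1) I.tangent ∞ (fun t => (⟨c t, toFun t⟩ : TangentBundle I M))

instance (c : Imm I M) : CoeFun (TImm c) (fun _ => ∀ t : unitInterval, TangentSpace I (c t)) :=
  ⟨TImm.toFun⟩

/-- A tangent vector `h` at `c`, seen as a curve in `TM`. -/
def TImm.curve {c : Imm I M} (h : TImm c) (t : unitInterval) : TangentBundle I M := ⟨c t, h t⟩

/-- The tangent space at `(c, h)` to the tangent bundle of the space of immersions: smooth vector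
fields along the curve `h` in `TM`. -/
structure TTImm {c : Imm I M} (h : TImm c) where
  toFun : ∀ t : unitInterval, TangentSpace I.tangent (h.curve t)
  smooth : ContMDiff (𝓡∂ 1) I.tangent.tangent ∞
    (fun t => (⟨h.curve t, toFun t⟩ : TangentBundle I.tangent (TangentBundle I M)))

instance {c : Imm I M} (h : TImm c) :
    CoeFun (TTImm h) (fun _ => ∀ t : unitInterval, TangentSpace I.tangent (h.curve t)) :=
  ⟨TTImm.toFun⟩

/-- `γ` is a path in the space of immersions, smooth for parameters `s` near `0`: the map
`(s, t) ↦ γ s t` is smooth. -/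
def IsSmoothPath (γ : ℝ → Imm I M) : Prop :=
  ∃ ε > 0, ContMDiffOn (𝓘(ℝ, ℝ).prod (𝓡∂ 1)) I ∞
    (fun q : ℝ × unitInterval => γ q.1 q.2) (Set.Ioo (-ε) ε ×ˢ Set.univ)

/-- The smooth path `γ` in the space of immersions passes through `c` at time `0` at speed `h`. -/
def Represents (γ : ℝ → Imm I M) (c : Imm I M) (h : TImm c) : Prop :=
  IsSmoothPath γ ∧ ∀ t : unitInterval,
    (⟨γ 0 t, mfderiv 𝓘(ℝ, ℝ) I (fun s : ℝ => γ s t) 0 (1 : ℝ)⟩ : TangentBundle I M) = h.curve t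

lemma contMDiff_vel (c : Imm I M) :
    ContMDiff (𝓡∂ 1) I.tangent ∞ (fun t => (⟨c t, c.vel t⟩ : TangentBundle I M)) := by
  have hf : ContMDiffOn 𝓘(ℝ, ℝ) I ∞ (c ∘ Set.projIcc (0 : ℝ) 1 zero_le_one) (Set.Icc 0 1) :=
    contMDiffOn_comp_projIcc_iff.2 c.smooth
  have hT := hf.contMDiffOn_tangentMapWithin (m := ∞) (by simp)
    (uniqueDiffOn_Icc zero_lt_one).uniqueMDiffOn
  have hs : ContMDiff (𝓡∂ 1) 𝓘(ℝ, ℝ).tangent ∞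
      (fun t : unitInterval => (⟨(t : ℝ), (1 : ℝ)⟩ : TangentBundle 𝓘(ℝ, ℝ) ℝ)) := by
    intro t
    rw [Bundle.contMDiffAt_totalSpace]
    refine ⟨contMDiff_subtypeVal_Icc.contMDiffAt, ?_⟩
    simpa using contMDiffAt_const
  have h := hT.comp_contMDiff hs (fun t => t.2)
  refine h.congr fun t => ?_
  refine TotalSpace.ext ?_ (heq_of_eq ?_)
  · exact congrArg c (Set.projIcc_val zero_le_one t).symm
  · exact (mfderivWithin_comp_projIcc_one (I := I) (f := c.toFun) (w := t)).symm

end Curves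

section Metrics

variable {E : Type*} [NormedAddCommGroup E] [NormedSpace ℝ E]
  {H : Type*} [TopologicalSpace H] {I : ModelWithCorners ℝ E H}
  {M : Type*} [TopologicalSpace M] [ChartedSpace H M] [IsManifold I ∞ M]
  [RiemannianBundle (fun x : M => TangentSpace I x)]
  [IsContMDiffRiemannianBundle I ∞ E (fun x : M => TangentSpace I x)]

lemma contMDiff_srvf (c : Imm I M) :
    ContMDiff (𝓡∂ 1) I.tangent ∞
      (fun t => (⟨c t, (√‖c.vel t‖)⁻¹ • c.vel t⟩ : TangentBundle I M)) := by
  have hv := contMDiff_vel c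
  have hi : ContMDiff (𝓡∂ 1) 𝓘(ℝ, ℝ) ∞ (fun t => inner ℝ (c.vel t) (c.vel t)) :=
    ContMDiff.inner_bundle hv hv
  have ha : ContMDiff (𝓡∂ 1) 𝓘(ℝ, ℝ) ∞ (fun t => (√‖c.vel t‖)⁻¹) := by
    intro t
    have hne : inner ℝ (c.vel t) (c.vel t) ≠ 0 := inner_self_ne_zero.2 (c.immersive t)
    have hg : ContDiffAt ℝ ∞ (fun x : ℝ => (√(√x))⁻¹) (inner ℝ (c.vel t) (c.vel t)) := by
      have h1 := Real.contDiffAt_sqrt (n := ∞) hne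
      have h0 : 0 < inner ℝ (c.vel t) (c.vel t) :=
        lt_of_le_of_ne real_inner_self_nonneg hne.symm
      exact (h1.sqrt (Real.sqrt_ne_zero'.2 h0)).inv
        (Real.sqrt_ne_zero'.2 (Real.sqrt_pos.2 h0))
    have := hg.contMDiffAt.comp t (hi t)
    refine this.congr_of_eventuallyEq (Filter.Eventually.of_forall fun x => ?_)
    simp only [Function.comp_apply, norm_eq_sqrt_real_inner]
  intro t
  have hvt := Bundle.contMDiffAt_totalSpace.1 (hv t)
  rw [Bundle.contMDiffAt_totalSpace]
  refine ⟨hvt.1, ?_⟩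
  refine ((ha t).smul hvt.2).congr_of_eventuallyEq ?_
  have hb : ∀ᶠ x in nhds t, c x ∈ (trivializationAt E (TangentSpace I) (c t)).baseSet :=
    c.smooth.continuous.continuousAt.eventually
      ((trivializationAt E (TangentSpace I) (c t)).open_baseSet.mem_nhds
        (mem_baseSet_trivializationAt E (TangentSpace I) (c t)))
  filter_upwards [hb] with x hx
  exact ((trivializationAt E (TangentSpace I) (c t)).linear ℝ hx).map_smul _ _

/-- The square root velocity function `R(c) = c' / √‖c'‖`. -/
def srvf (c : Imm I M) : TImm c := ⟨fun t => (√‖c.vel t‖)⁻¹ • c.vel t, contMDiff_srvf c⟩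

/-- `ξ` is the image `T_c R(h)` of `h` under the differential of the square root velocity function
at `c`: some path of immersions passes through `c` at speed `h`, and `R` maps each such path to a
path that passes through `R(c)` at speed `ξ`. -/
def IsTangentSRVF (c : Imm I M) (h : TImm c) (ξ : TTImm (srvf c)) : Prop :=
  (∃ γ : ℝ → Imm I M, Represents γ c h) ∧
  ∀ γ : ℝ → Imm I M, Represents γ c h → ∀ t : unitInterval,
    (⟨(srvf (γ 0)).curve t,
        mfderiv 𝓘(ℝ, ℝ) I.tangent (fun s : ℝ => (srvf (γ s)).curve t) 0 (1 : ℝ)⟩ :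
      TangentBundle I.tangent (TangentBundle I M)) = ⟨(srvf c).curve t, ξ t⟩

variable [FiniteDimensional ℝ E]

/-- `∇_ℓ h = ∇_{c'} h / ‖c'‖`, the covariant derivative of `h` along `c` according to arc length.
The covariant derivative `∇_{c'} h` is the vertical projection of the velocity of `h` in `TM`. -/
def covArc {c : Imm I M} (h : TImm c) (t : unitInterval) : TangentSpace I (c t) :=
  ‖c.vel t‖⁻¹ • vp (u := h.curve t) (mfderiv (𝓡∂ 1) I.tangent h.curve t 1)

/-- The tangential component `⟨∇_ℓ h, v⟩ v`, where `v = c' / ‖c'‖`. -/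
def covArcT {c : Imm I M} (h : TImm c) (t : unitInterval) : TangentSpace I (c t) :=
  inner ℝ (covArc h t) (‖c.vel t‖⁻¹ • c.vel t) • (‖c.vel t‖⁻¹ • c.vel t)

/-- The normal component of `∇_ℓ h`. -/
def covArcN {c : Imm I M} (h : TImm c) (t : unitInterval) : TangentSpace I (c t) :=
  covArc h t - covArcT h t

/-- The first-order Sobolev metric `G` on the space of immersions; arc length is
`dℓ = ‖c'(t)‖ dt`. -/
def G (c : Imm I M) (h k : TImm c) : ℝ :=
  inner ℝ (h 0) (k 0) +
    ∫ t : unitInterval, (inner ℝ (covArcN h t) (covArcN k t)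
      + 1 / 4 * inner ℝ (covArcT h t) (covArcT k t)) * ‖c.vel t‖

/-- The metric `G̃` on the tangent bundle of the space of immersions. -/
def GTilde {c : Imm I M} (h : TImm c) (ξ η : TTImm h) : ℝ :=
  inner ℝ (hp (ξ 0)) (hp (η 0)) + ∫ t : unitInterval, inner ℝ (vp (ξ t)) (vp (η t))

end Metrics

end SRV

end

noncomputable section

namespace SRV

open Filter Topology

section Smoothness

variable {E : Type*} [NormedAddCommGroup E] [NormedSpace ℝ E]
  {H : Type*} [TopologicalSpace H] {I : ModelWithCorners ℝ E H}
  {M : Type*} [TopologicalSpace M] [ChartedSpace H M]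

/-- The derivative of a smooth family of maps, applied to a smooth field of vectors, is smooth. -/
lemma contMDiffAt_mfderiv_apply [IsManifold I 1 M]
    {EN : Type*} [NormedAddCommGroup EN] [NormedSpace ℝ EN]
    {HN : Type*} [TopologicalSpace HN] {J : ModelWithCorners ℝ EN HN}
    {N : Type*} [TopologicalSpace N] [ChartedSpace HN N] [IsManifold J 1 N]
    {EX : Type*} [NormedAddCommGroup EX] [NormedSpace ℝ EX]
    {HX : Type*} [TopologicalSpace HX] {K : ModelWithCorners ℝ EX HX}
    {X : Type*} [TopologicalSpace X] [ChartedSpace HX X] [IsManifold K 1 X]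
    {f : N → X → M} {g : N → X} {v : ∀ x, TangentSpace K (g x)} {x₀ : N}
    (hf : ContMDiffAt (J.prod K) I ∞ (Function.uncurry f) (x₀, g x₀))
    (hv : ContMDiffAt J K.tangent ∞ (fun x => (⟨g x, v x⟩ : TangentBundle K X)) x₀) :
    ContMDiffAt J I.tangent ∞
      (fun x => (⟨f x (g x), mfderiv K I (f x) (g x) (v x)⟩ : TangentBundle I M)) x₀ := by
  have hg : ContMDiffAt J K ∞ g x₀ := (Bundle.contMDiffAt_totalSpace.1 hv).1
  have hb : ContMDiffAt J I ∞ (fun x => f x (g x)) x₀ :=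
    ContMDiffAt.comp (I' := J.prod K) x₀ (f := fun x => (x, g x)) hf (contMDiffAt_id.prodMk hg)
  exact ContMDiffAt.clm_apply_of_inCoordinates (hf.mfderiv f g hg (m := ∞) (by simp)) hv hb

/-- The unit vector field on the unit interval is smooth. -/
lemma contMDiff_one_unitInterval :
    ContMDiff (𝓡∂ 1) (𝓡∂ 1).tangent ∞
      (fun t : unitInterval => (⟨t, 1⟩ : TangentBundle (𝓡∂ 1) unitInterval)) := by
  have hT := (contMDiffOn_projIcc (x := 0) (y := 1) (n := ∞)).contMDiffOn_tangentMapWithin (m := ∞)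
    (by simp) (uniqueDiffOn_Icc zero_lt_one).uniqueMDiffOn
  have hs : ContMDiff (𝓡∂ 1) 𝓘(ℝ, ℝ).tangent ∞
      (fun t : unitInterval => (⟨(t : ℝ), (1 : ℝ)⟩ : TangentBundle 𝓘(ℝ, ℝ) ℝ)) := by
    intro t
    rw [Bundle.contMDiffAt_totalSpace]
    refine ⟨contMDiff_subtypeVal_Icc.contMDiffAt, ?_⟩
    simpa using contMDiffAt_const
  refine (hT.comp_contMDiff hs (fun t => t.2)).congr fun t => ?_
  have ht := Set.projIcc_val (zero_le_one (α := ℝ)) t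
  have h1 : mfderivWithin 𝓘(ℝ, ℝ) (𝓡∂ 1) (Set.projIcc (0 : ℝ) 1 zero_le_one) (Set.Icc 0 1) (t : ℝ)
      (1 : ℝ) = (1 : TangentSpace (𝓡∂ 1) (Set.projIcc (0 : ℝ) 1 zero_le_one t)) :=
    mfderivWithin_projIcc_one t.2
  have h2 : (⟨t, 1⟩ : TangentBundle (𝓡∂ 1) unitInterval) =
      ⟨Set.projIcc (0 : ℝ) 1 zero_le_one t, 1⟩ := by rw [ht]
  rw [h2]
  exact congrArg (fun w => (⟨Set.projIcc (0 : ℝ) 1 zero_le_one t, w⟩ :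
    TangentBundle (𝓡∂ 1) unitInterval)) h1.symm

variable [IsManifold I 1 M]

/-- The velocity in `t` of a smooth family of curves `t ↦ Γ (s, t)` is smooth in `(s, t)`. -/
lemma contMDiffAt_snd_velocity {Γ : ℝ × unitInterval → M} {q : ℝ × unitInterval}
    (hΓ : ContMDiffAt (𝓘(ℝ, ℝ).prod (𝓡∂ 1)) I ∞ Γ q) :
    ContMDiffAt (𝓘(ℝ, ℝ).prod (𝓡∂ 1)) I.tangent ∞ (fun q : ℝ × unitInterval =>
      (⟨Γ q, mfderiv (𝓡∂ 1) I (fun t => Γ (q.1, t)) q.2 1⟩ : TangentBundle I M)) q := by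
  refine contMDiffAt_mfderiv_apply (f := fun (q : ℝ × unitInterval) t => Γ (q.1, t)) (g := Prod.snd)
    (v := fun q => (1 : TangentSpace (𝓡∂ 1) q.2)) ?_ ?_
  · exact hΓ.comp (q, q.2) (contMDiffAt_fst.fst.prodMk contMDiffAt_snd)
  · exact contMDiff_one_unitInterval.contMDiffAt.comp q contMDiffAt_snd

/-- The velocity at `s = 0` of a smooth family of curves `s ↦ Γ (s, t)` is smooth in `t`. -/
lemma contMDiffAt_fst_velocity {Γ : ℝ × unitInterval → M} {t : unitInterval}
    (hΓ : ContMDiffAt (𝓘(ℝ, ℝ).prod (𝓡∂ 1)) I ∞ Γ (0, t)) :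
    ContMDiffAt (𝓡∂ 1) I.tangent ∞ (fun t : unitInterval =>
      (⟨Γ (0, t), mfderiv 𝓘(ℝ, ℝ) I (fun s : ℝ => Γ (s, t)) 0 (1 : ℝ)⟩ : TangentBundle I M)) t := by
  refine contMDiffAt_mfderiv_apply (f := fun (t : unitInterval) (s : ℝ) => Γ (s, t))
    (g := fun _ => (0 : ℝ)) (v := fun _ => (1 : ℝ)) ?_ contMDiffAt_const
  exact ContMDiffAt.comp (t, (0 : ℝ)) hΓ (contMDiffAt_snd.prodMk contMDiffAt_fst)

end Smoothness

section MixedPartials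

variable {E : Type*} [NormedAddCommGroup E] [NormedSpace ℝ E]

lemma mfderiv_one_eq_of_hasDerivWithinAt {g : unitInterval → E} {t : unitInterval} {g' : E}
    (hg : HasDerivWithinAt (g ∘ Set.projIcc (0 : ℝ) 1 zero_le_one) g' (Set.Icc 0 1) t) :
    mfderiv (𝓡∂ 1) 𝓘(ℝ, E) g t 1 = g' := by
  have h := mfderivWithin_comp_projIcc_one (I := 𝓘(ℝ, E)) (f := g) (w := t)
  rw [mfderivWithin_eq_fderivWithin] at h
  refine Eq.trans h.symm ?_
  exact hg.derivWithin (uniqueDiffOn_Icc zero_lt_one t t.2)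

/-- Partial derivatives commute, up to the boundary of the strip `ℝ × [0,1]`. -/
lemma deriv_mfderiv_comm {f : ℝ × unitInterval → E} {t₀ : unitInterval}
    (hf : ContMDiffAt (𝓘(ℝ, ℝ).prod (𝓡∂ 1)) 𝓘(ℝ, E) ∞ f (0, t₀)) :
    deriv (fun s : ℝ => (mfderiv (𝓡∂ 1) 𝓘(ℝ, E) (fun t => f (s, t)) t₀ 1 : E)) 0 =
      mfderiv (𝓡∂ 1) 𝓘(ℝ, E) (fun t => deriv (fun s : ℝ => f (s, t)) 0) t₀ 1 := by
  set pr : ℝ → unitInterval := Set.projIcc (0 : ℝ) 1 zero_le_one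
  set S : Set (ℝ × ℝ) := Set.univ ×ˢ Set.Icc (0 : ℝ) 1 with hS
  set F : ℝ × ℝ → E := fun x => f (x.1, pr x.2) with hF
  have hx₀ : ((0 : ℝ), (t₀ : ℝ)) ∈ S := ⟨trivial, t₀.2⟩
  have hprt (t : unitInterval) : pr t = t := Set.projIcc_val zero_le_one t
  have hSu : UniqueDiffOn ℝ S := uniqueDiffOn_univ.prod (uniqueDiffOn_Icc zero_lt_one)
  have hFs : ContDiffWithinAt ℝ ∞ F S (0, (t₀ : ℝ)) := by
    rw [← contMDiffWithinAt_iff_contDiffWithinAt]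
    have h1 : ContMDiffWithinAt 𝓘(ℝ, ℝ × ℝ) 𝓘(ℝ, ℝ) ∞ (Prod.fst : ℝ × ℝ → ℝ) S (0, (t₀ : ℝ)) :=
      contDiff_fst.contMDiff.contMDiffAt.contMDiffWithinAt
    have h2 : ContMDiffWithinAt 𝓘(ℝ, ℝ × ℝ) (𝓡∂ 1) ∞ (fun x : ℝ × ℝ => pr x.2) S (0, (t₀ : ℝ)) :=
      (contMDiffOn_projIcc (x := 0) (y := 1) (t₀ : ℝ) t₀.2).comp (0, (t₀ : ℝ))
        (contDiff_snd.contMDiff.contMDiffAt.contMDiffWithinAt) (fun x hx => hx.2)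
    refine ContMDiffAt.comp_contMDiffWithinAt_of_eq hf (h1.prodMk h2) ?_
    exact Prod.ext rfl (hprt t₀)
  have hF2 : ContDiffWithinAt ℝ 2 F S (0, (t₀ : ℝ)) := hFs.of_le ENat.LEInfty.out
  have hev : ∀ᶠ x in 𝓝[S] ((0 : ℝ), (t₀ : ℝ)), HasFDerivWithinAt F (fderivWithin ℝ F S x) S x := by
    have := hF2.eventually (by simp)
    rw [Set.insert_eq_of_mem hx₀] at this
    filter_upwards [this] with x hx
    exact (hx.differentiableWithinAt (by simp)).hasFDerivWithinAt
  have hd2 : HasFDerivWithinAt (fderivWithin ℝ F S)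
      (fderivWithin ℝ (fderivWithin ℝ F S) S (0, (t₀ : ℝ))) S (0, (t₀ : ℝ)) :=
    ((hF2.fderivWithin_right hSu (m := 1) (by norm_num) hx₀).differentiableWithinAt
      one_ne_zero).hasFDerivWithinAt
  have hsymm := hF2.isSymmSndFDerivWithinAt (by simp) hSu (by
    rw [hS, interior_prod_eq, interior_univ, closure_prod_eq, interior_Icc,
      closure_Ioo zero_ne_one]
    simp) hx₀
  have hline (t : ℝ) (s : ℝ) :
      HasDerivAt (fun s : ℝ => (s, t)) (1, 0) s :=
    (hasDerivAt_id s).prodMk (hasDerivAt_const s t)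
  have hline' (s : ℝ) (t : ℝ) :
      HasDerivAt (fun t : ℝ => (s, t)) (0, 1) t :=
    (hasDerivAt_const t s).prodMk (hasDerivAt_id t)
  have ht1 : Tendsto (fun s : ℝ => (s, (t₀ : ℝ))) (𝓝 0) (𝓝[S] ((0 : ℝ), (t₀ : ℝ))) :=
    tendsto_nhdsWithin_iff.2 ⟨(hline t₀ 0).continuousAt, Eventually.of_forall fun s => ⟨trivial, t₀.2⟩⟩
  have ht2 : Tendsto (fun t : ℝ => ((0 : ℝ), t)) (𝓝[Set.Icc 0 1] (t₀ : ℝ))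
      (𝓝[S] ((0 : ℝ), (t₀ : ℝ))) :=
    tendsto_nhdsWithin_iff.2 ⟨(hline' 0 t₀).continuousAt.continuousWithinAt,
      eventually_mem_nhdsWithin.mono fun t ht => ⟨trivial, ht⟩⟩
  have hleft : deriv (fun s : ℝ => (mfderiv (𝓡∂ 1) 𝓘(ℝ, E) (fun t => f (s, t)) t₀ 1 : E)) 0 =
      fderivWithin ℝ (fderivWithin ℝ F S) S (0, (t₀ : ℝ)) (1, 0) (0, 1) := by
    have e1 : (fun s : ℝ => (mfderiv (𝓡∂ 1) 𝓘(ℝ, E) (fun t => f (s, t)) t₀ 1 : E)) =ᶠ[𝓝 0]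
        fun s => fderivWithin ℝ F S (s, (t₀ : ℝ)) (0, 1) := by
      filter_upwards [ht1.eventually hev] with s hs
      refine mfderiv_one_eq_of_hasDerivWithinAt ?_
      exact hs.comp_hasDerivWithinAt (t₀ : ℝ) (hline' s t₀).hasDerivWithinAt
        (fun t ht => ⟨trivial, ht⟩)
    have e2 : HasDerivAt (fun s : ℝ => fderivWithin ℝ F S (s, (t₀ : ℝ)))
        (fderivWithin ℝ (fderivWithin ℝ F S) S (0, (t₀ : ℝ)) (1, 0)) 0 := by
      rw [← hasDerivWithinAt_univ]
      exact hd2.comp_hasDerivWithinAt (0 : ℝ) (hline t₀ 0).hasDerivWithinAt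
        (s := Set.univ) (fun s _ => Set.mk_mem_prod trivial t₀.2)
    rw [e1.deriv_eq]
    simpa using (e2.clm_apply (hasDerivAt_const (0 : ℝ) ((0 : ℝ), (1 : ℝ)))).deriv
  have hright : mfderiv (𝓡∂ 1) 𝓘(ℝ, E) (fun t => deriv (fun s : ℝ => f (s, t)) 0) t₀ 1 =
      fderivWithin ℝ (fderivWithin ℝ F S) S (0, (t₀ : ℝ)) (0, 1) (1, 0) := by
    refine mfderiv_one_eq_of_hasDerivWithinAt ?_
    have e2 : HasDerivWithinAt (fun t : ℝ => fderivWithin ℝ F S (0, t))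
        (fderivWithin ℝ (fderivWithin ℝ F S) S (0, (t₀ : ℝ)) (0, 1)) (Set.Icc 0 1) t₀ := by
      exact hd2.comp_hasDerivWithinAt (t₀ : ℝ) (hline' 0 t₀).hasDerivWithinAt
        (fun t ht => ⟨trivial, ht⟩)
    have e3 := e2.clm_apply (hasDerivWithinAt_const (t₀ : ℝ) (Set.Icc 0 1) ((1 : ℝ), (0 : ℝ)))
    simp only [map_zero, add_zero] at e3
    have e1 : ((fun t => deriv (fun s : ℝ => f (s, t)) 0) ∘ pr) =ᶠ[𝓝[Set.Icc 0 1] (t₀ : ℝ)]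
        fun t => fderivWithin ℝ F S (0, t) (1, 0) := by
      filter_upwards [ht2.eventually hev, self_mem_nhdsWithin] with t ht htI
      refine HasDerivAt.deriv ?_
      rw [← hasDerivWithinAt_univ]
      exact ht.comp_hasDerivWithinAt (0 : ℝ) (hline t 0).hasDerivWithinAt
        (s := Set.univ) (fun s _ => Set.mk_mem_prod trivial htI)
    exact e3.congr_of_eventuallyEq_of_mem e1 t₀.2
  rw [hleft, hright]
  exact hsymm _ _

end MixedPartials

section NormedSpaceValued

variable {E : Type*} [NormedAddCommGroup E] [NormedSpace ℝ E]
  {H : Type*} [TopologicalSpace H] {I : ModelWithCorners ℝ E H}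
  {M : Type*} [TopologicalSpace M] [ChartedSpace H M]
  {F : Type*} [NormedAddCommGroup F] [NormedSpace ℝ F]

lemma mdifferentiableAt_bilinear [FiniteDimensional ℝ F] {A : M → F →L[ℝ] F →L[ℝ] ℝ} {p : M}
    (h : ∀ v w, MDifferentiableAt I 𝓘(ℝ, ℝ) (fun x => A x v w) p) :
    MDifferentiableAt I 𝓘(ℝ, F →L[ℝ] F →L[ℝ] ℝ) A p := by
  let b := Module.finBasis ℝ F
  let φ (i) : F →L[ℝ] ℝ := (b.coord i).toContinuousLinearMap
  have hsum : A = ∑ i, ∑ j, fun x => A x (b i) (b j) • (φ i).smulRight (φ j) := by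
    ext x v w
    conv_lhs => rw [← b.sum_repr v, ← b.sum_repr w]
    simp only [map_sum, map_smul, sum_apply, smul_apply, Finset.sum_apply,
      ContinuousLinearMap.smulRight_apply, smul_eq_mul, φ, LinearMap.coe_toContinuousLinearMap',
      Module.Basis.coord_apply, Finset.mul_sum]
    refine Finset.sum_comm.trans (Finset.sum_congr rfl fun i _ => Finset.sum_congr rfl fun j _ => ?_)
    ring
  rw [hsum]
  exact MDifferentiableAt.sum fun i _ => MDifferentiableAt.sum fun j _ =>
    (h (b i) (b j)).smul mdifferentiableAt_const

lemma mfderiv_clm_comp {G : Type*} [NormedAddCommGroup G] [NormedSpace ℝ G] (L : F →L[ℝ] G)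
    {A : M → F} {p : M} (hA : MDifferentiableAt I 𝓘(ℝ, F) A p) (z : TangentSpace I p) :
    mfderiv I 𝓘(ℝ, G) (fun x => L (A x)) p z = L (mfderiv I 𝓘(ℝ, F) A p z) := by
  have h := (L.hasFDerivAt (x := A p)).hasMFDerivAt.comp p hA.hasMFDerivAt
  exact DFunLike.congr_fun h.mfderiv z

lemma hasDerivAt_comp_of_mdifferentiableAt {A : M → F} {x : ℝ → M} {s : ℝ}
    (hA : MDifferentiableAt I 𝓘(ℝ, F) A (x s)) (hx : MDifferentiableAt 𝓘(ℝ, ℝ) I x s) :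
    HasDerivAt (fun r => A (x r))
      (mfderiv I 𝓘(ℝ, F) A (x s) (mfderiv 𝓘(ℝ, ℝ) I x s (1 : ℝ))) s := by
  have hd : DifferentiableAt ℝ (fun r => A (x r)) s := (hA.comp s hx).differentiableAt
  have h := DFunLike.congr_fun (mfderiv_comp s hA hx) (1 : ℝ)
  rw [mfderiv_eq_fderiv] at h
  exact hd.hasDerivAt.congr_deriv h

end NormedSpaceValued

section Trivialization

variable {E : Type*} [NormedAddCommGroup E] [NormedSpace ℝ E]
  {H : Type*} [TopologicalSpace H] {I : ModelWithCorners ℝ E H}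
  {M : Type*} [TopologicalSpace M] [ChartedSpace H M] [IsManifold I ∞ M]

lemma trivializationAt_snd {p x : M} (v : TangentSpace I x)
    (hx : x ∈ (trivializationAt E (TangentSpace I) p).baseSet) :
    (trivializationAt E (TangentSpace I) p (⟨x, v⟩ : TangentBundle I M)).2 =
      (trivializationAt E (TangentSpace I) p).continuousLinearMapAt ℝ x v := by
  rw [Trivialization.continuousLinearMapAt_apply, Trivialization.linearMapAt_apply, if_pos hx]

lemma trivializationAt_snd_eq_mfderiv {p x : M} (v : TangentSpace I x)
    (hx : x ∈ (chartAt H p).source) :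
    (trivializationAt E (TangentSpace I) p (⟨x, v⟩ : TangentBundle I M)).2 =
      mfderiv I 𝓘(ℝ, E) (extChartAt I p) x v := by
  rw [trivializationAt_snd v hx, TangentBundle.continuousLinearMapAt_trivializationAt hx]
  rfl

lemma contMDiffAt_trivializationAt_snd {p : M} {u : TangentBundle I M}
    (hu : u.proj ∈ (trivializationAt E (TangentSpace I) p).baseSet) :
    ContMDiffAt I.tangent 𝓘(ℝ, E) ∞
      (fun w : TangentBundle I M => (trivializationAt E (TangentSpace I) p w).2) u := by
  have := (trivializationAt E (TangentSpace I) p).contMDiffAt_iff (IB := I) (IM := I.tangent) (n := ∞)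
    (f := fun w : TangentBundle I M => w) (x₀ := u)
    ((trivializationAt E (TangentSpace I) p).mem_source.2 hu)
  exact (this.1 contMDiffAt_id).2

lemma contMDiffAt_trivializationAt_symm {p x : M} (v : E)
    (hx : x ∈ (trivializationAt E (TangentSpace I) p).baseSet) :
    ContMDiffAt I I.tangent ∞ (fun y => (⟨y, (trivializationAt E (TangentSpace I) p).symmL ℝ y v⟩ :
      TangentBundle I M)) x := by
  have h1 : ContMDiffAt I I.tangent ∞ (fun y : M =>
      (trivializationAt E (TangentSpace I) p).toOpenPartialHomeomorph.symm (y, v)) x :=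
    ContMDiffAt.comp x ((trivializationAt E (TangentSpace I) p).contMDiffOn_symm.contMDiffAt
      ((trivializationAt E (TangentSpace I) p).open_target.mem_nhds
        ((trivializationAt E (TangentSpace I) p).mem_target.2 hx)))
      (contMDiffAt_id.prodMk contMDiffAt_const)
  refine h1.congr_of_eventuallyEq ?_
  filter_upwards [(trivializationAt E (TangentSpace I) p).open_baseSet.mem_nhds hx] with y hy
  rw [Trivialization.symmL_apply _ hy]
  exact (trivializationAt E (TangentSpace I) p).mk_symm hy v

lemma hp_mfderiv {EX : Type*} [NormedAddCommGroup EX] [NormedSpace ℝ EX]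
    {HX : Type*} [TopologicalSpace HX] {K : ModelWithCorners ℝ EX HX}
    {X : Type*} [TopologicalSpace X] [ChartedSpace HX X]
    {U : X → TangentBundle I M} {x : X} (hU : MDifferentiableAt K I.tangent U x)
    (v : TangentSpace K x) :
    hp (u := U x) (mfderiv K I.tangent U x v) = mfderiv K I (fun r => (U r).proj) x v := by
  have h1 : MDifferentiableAt I.tangent I (TotalSpace.proj : TangentBundle I M → M) (U x) :=
    (Bundle.contMDiff_proj (n := 1) (TangentSpace I : M → Type _)).mdifferentiableAt one_ne_zero
  exact (DFunLike.congr_fun (mfderiv_comp x h1 hU) v).symm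

end Trivialization

section Connection

variable {E : Type*} [NormedAddCommGroup E] [NormedSpace ℝ E]
  {H : Type*} [TopologicalSpace H] {I : ModelWithCorners ℝ E H}
  {M : Type*} [TopologicalSpace M] [ChartedSpace H M] [IsManifold I ∞ M]
  [RiemannianBundle (fun x : M => TangentSpace I x)]

lemma metricInChart_apply (p x : M) (v w : E) :
    metricInChart I p x v w = inner ℝ ((trivializationAt E (TangentSpace I) p).symmL ℝ x v)
      ((trivializationAt E (TangentSpace I) p).symmL ℝ x w) := rfl

lemma metricInChart_comm (p x : M) (v w : E) :
    metricInChart I p x v w = metricInChart I p x w v := by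
  rw [metricInChart_apply, metricInChart_apply, real_inner_comm]

lemma metricInChart_trivializationAt {p x : M}
    (hx : x ∈ (trivializationAt E (TangentSpace I) p).baseSet) (v w : TangentSpace I x) :
    metricInChart I p x (trivializationAt E (TangentSpace I) p (⟨x, v⟩ : TangentBundle I M)).2
      (trivializationAt E (TangentSpace I) p (⟨x, w⟩ : TangentBundle I M)).2 = inner ℝ v w := by
  rw [metricInChart_apply, trivializationAt_snd v hx, trivializationAt_snd w hx,
    Trivialization.symmL_continuousLinearMapAt _ hx, Trivialization.symmL_continuousLinearMapAt _ hx]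

variable (I) in
/-- The derivative at `p` of the Gram form of the metric in the chart at `p`. -/
def dMetric (p : M) : TangentSpace I p →L[ℝ] E →L[ℝ] E →L[ℝ] ℝ :=
  mfderiv I 𝓘(ℝ, E →L[ℝ] E →L[ℝ] ℝ) (metricInChart I p) p

variable [FiniteDimensional ℝ E]

lemma inner_christoffel_eq (p : M) (v w z : TangentSpace I p) :
    letI e : TangentSpace I p →L[ℝ] E :=
      (trivializationAt E (TangentSpace I) p).continuousLinearMapAt ℝ p
    inner ℝ (christoffel I p v w) z =
      (dMetric I p v (e w) (e z) + dMetric I p w (e v) (e z) - dMetric I p z (e v) (e w)) / 2 :=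
  inner_christoffel I p v w z

section

variable [IsContMDiffRiemannianBundle I ∞ E (fun x : M => TangentSpace I x)]

lemma mdifferentiableAt_metricInChart (p : M) :
    MDifferentiableAt I 𝓘(ℝ, E →L[ℝ] E →L[ℝ] ℝ) (metricInChart I p) p := by
  have hp : p ∈ (trivializationAt E (TangentSpace I) p).baseSet :=
    mem_baseSet_trivializationAt E (TangentSpace I) p
  have hs (v w : E) : MDifferentiableAt I 𝓘(ℝ, ℝ) (fun x => metricInChart I p x v w) p := by
    have hc : ContMDiffAt I 𝓘(ℝ, ℝ) ∞ (fun x : M =>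
        inner ℝ (((trivializationAt E (TangentSpace I) p).symmL ℝ x v : TangentSpace I x))
          ((trivializationAt E (TangentSpace I) p).symmL ℝ x w : TangentSpace I x)) p :=
      ContMDiffAt.inner_bundle (E := fun x : M => TangentSpace I x)
        (contMDiffAt_trivializationAt_symm v hp) (contMDiffAt_trivializationAt_symm w hp)
    exact hc.mdifferentiableAt (by simp)
  exact mdifferentiableAt_bilinear hs

set_option synthInstance.maxHeartbeats 200000 in
lemma dMetric_apply (p : M) (v w : E) (z : TangentSpace I p) :
    dMetric I p z v w = mfderiv I 𝓘(ℝ, ℝ) (fun x => metricInChart I p x v w) p z := by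
  exact (mfderiv_clm_comp ((ContinuousLinearMap.apply ℝ ℝ w).comp
    (ContinuousLinearMap.apply ℝ (E →L[ℝ] ℝ) v)) (mdifferentiableAt_metricInChart p) z).symm

lemma dMetric_comm (p : M) (v w : E) (z : TangentSpace I p) :
    dMetric I p z v w = dMetric I p z w v := by
  rw [dMetric_apply, dMetric_apply]
  exact congrArg (fun f : M → ℝ => (mfderiv I 𝓘(ℝ, ℝ) f p z : ℝ))
    (funext fun x => metricInChart_comm p x v w)

/-- The Levi-Civita connection is torsion-free. -/
lemma christoffel_comm (p : M) (v w : TangentSpace I p) :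
    christoffel I p v w = christoffel I p w v := by
  refine ext_inner_right ℝ fun z => ?_
  rw [inner_christoffel_eq, inner_christoffel_eq, dMetric_comm p _ _ z]
  ring

end

set_option synthInstance.maxHeartbeats 200000 in
lemma christoffel_smul (p : M) (v w : TangentSpace I p) (a : ℝ) :
    christoffel I p v (a • w) = a • christoffel I p v w := by
  refine ext_inner_right ℝ fun z => ?_
  rw [real_inner_smul_left, inner_christoffel_eq, inner_christoffel_eq]
  simp only [map_smul, smul_apply, smul_eq_mul]
  ring

/-- The vertical projection of the velocity of a map into `TM`, in coordinates. -/
lemma vp_mfderiv {EX : Type*} [NormedAddCommGroup EX] [NormedSpace ℝ EX]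
    {HX : Type*} [TopologicalSpace HX] {K : ModelWithCorners ℝ EX HX}
    {X : Type*} [TopologicalSpace X] [ChartedSpace HX X]
    {U : X → TangentBundle I M} {x : X} (hU : MDifferentiableAt K I.tangent U x)
    (v : TangentSpace K x) :
    vp (u := U x) (mfderiv K I.tangent U x v) =
      (trivializationAt E (TangentSpace I) (U x).proj).symmL ℝ (U x).proj
        (mfderiv K 𝓘(ℝ, E) (fun r => (trivializationAt E (TangentSpace I) (U x).proj (U r)).2) x v)
      + christoffel I (U x).proj (mfderiv K I (fun r => (U r).proj) x v) (U x).snd := by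
  have h2 : MDifferentiableAt I.tangent 𝓘(ℝ, E) (fun w : TangentBundle I M =>
      (trivializationAt E (TangentSpace I) (U x).proj w).2) (U x) :=
    (contMDiffAt_trivializationAt_snd (mem_baseSet_trivializationAt E (TangentSpace I)
      (U x).proj)).mdifferentiableAt (by simp)
  have e2 := DFunLike.congr_fun (mfderiv_comp x h2 hU) v
  unfold vp
  rw [hp_mfderiv hU]
  congr 2
  exact e2.symm

/-- A vector tangent to `TM` is determined by its horizontal and vertical projections. -/
lemma eq_of_hp_eq_of_vp_eq {u : TangentBundle I M} {ξ η : TangentSpace I.tangent u}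
    (h₁ : hp ξ = hp η) (h₂ : vp ξ = vp η) : ξ = η := by
  set e := trivializationAt E (TangentSpace I) u.proj with he
  have hu : u.proj ∈ e.baseSet := mem_baseSet_trivializationAt E (TangentSpace I) u.proj
  have hus : u ∈ e.source := e.mem_source.2 hu
  have hsnd : MDifferentiableAt I.tangent 𝓘(ℝ, E) (fun w : TangentBundle I M => (e w).2) u :=
    (contMDiffAt_trivializationAt_snd hu).mdifferentiableAt (by simp)
  have hfst : MDifferentiableAt I.tangent I (TotalSpace.proj : TangentBundle I M → M) u :=
    (Bundle.contMDiff_proj (n := 1) (TangentSpace I : M → Type _)).mdifferentiableAt one_ne_zero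
  have h₃ : mfderiv I.tangent 𝓘(ℝ, E) (fun w : TangentBundle I M => (e w).2) u ξ =
      mfderiv I.tangent 𝓘(ℝ, E) (fun w : TangentBundle I M => (e w).2) u η := by
    unfold vp at h₂
    rw [h₁] at h₂
    have h := congrArg (e.continuousLinearMapAt ℝ u.proj) (add_right_cancel h₂)
    exact (e.continuousLinearMapAt_symmL hu _).symm.trans
      (h.trans (e.continuousLinearMapAt_symmL hu _))
  have hpair := mfderiv_prodMk hfst hsnd
  have hsymm : MDifferentiableAt (I.prod 𝓘(ℝ, E)) I.tangent e.toOpenPartialHomeomorph.symm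
      (u.proj, (e u).2) :=
    (e.contMDiffOn_symm (n := 1).contMDiffAt (e.open_target.mem_nhds
      (e.mem_target.2 hu))).mdifferentiableAt one_ne_zero
  have hcomp := mfderiv_comp u hsymm (hfst.prodMk hsnd)
  have hid : (e.toOpenPartialHomeomorph.symm ∘ fun w : TangentBundle I M => (w.proj, (e w).2))
      =ᶠ[𝓝 u] id := by
    filter_upwards [e.open_source.mem_nhds hus] with w hw
    have : (w.proj, (e w).2) = e w := Prod.ext (e.coe_fst hw).symm rfl
    simp only [Function.comp_apply, this, id]
    exact e.left_inv hw
  rw [hid.mfderiv_eq, mfderiv_id, hpair] at hcomp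
  have a := DFunLike.congr_fun hcomp ξ
  have b := DFunLike.congr_fun hcomp η
  refine a.trans (Eq.trans ?_ b.symm)
  refine congrArg (mfderiv (I.prod 𝓘(ℝ, E)) I.tangent e.toOpenPartialHomeomorph.symm
      (u.proj, (e u).2)) ?_
  exact Prod.ext h₁ h₃

/-- The Levi-Civita connection is compatible with the metric. -/
lemma hasDerivAt_inner_self [IsContMDiffRiemannianBundle I ∞ E (fun x : M => TangentSpace I x)]
    {U : ℝ → TangentBundle I M} {s : ℝ} (hU : MDifferentiableAt 𝓘(ℝ, ℝ) I.tangent U s) :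
    HasDerivAt (fun r => inner ℝ (U r).snd (U r).snd)
      (2 * inner ℝ (vp (u := U s) (mfderiv 𝓘(ℝ, ℝ) I.tangent U s (1 : ℝ))) (U s).snd) s := by
  set e := trivializationAt E (TangentSpace I) (U s).proj with he
  have hb : (U s).proj ∈ e.baseSet := mem_baseSet_trivializationAt E (TangentSpace I) (U s).proj
  have hproj : MDifferentiableAt 𝓘(ℝ, ℝ) I (fun r => (U r).proj) s :=
    MDifferentiableAt.comp s
      ((Bundle.contMDiff_proj (n := 1) (TangentSpace I : M → Type _)).mdifferentiableAt
        one_ne_zero) hU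
  have hy : DifferentiableAt ℝ (fun r => (e (U r)).2) s := by
    rw [← mdifferentiableAt_iff_differentiableAt]
    exact MDifferentiableAt.comp (g := fun w : TangentBundle I M => (e w).2) s
      ((contMDiffAt_trivializationAt_snd hb).mdifferentiableAt (by simp)) hU
  have hg : HasDerivAt (fun r => metricInChart I (U s).proj (U r).proj)
      (dMetric I (U s).proj (mfderiv 𝓘(ℝ, ℝ) I (fun r => (U r).proj) s (1 : ℝ))) s :=
    hasDerivAt_comp_of_mdifferentiableAt (mdifferentiableAt_metricInChart _) hproj
  have hd := (hg.clm_apply hy.hasDerivAt).clm_apply hy.hasDerivAt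
  have hev : (fun r => inner ℝ (U r).snd (U r).snd) =ᶠ[𝓝 s]
      fun r => metricInChart I (U s).proj (U r).proj (e (U r)).2 (e (U r)).2 := by
    filter_upwards [hproj.continuousAt.eventually (e.open_baseSet.mem_nhds hb)] with r hr
    exact (metricInChart_trivializationAt hr _ _).symm
  refine (hd.congr_of_eventuallyEq hev).congr_deriv ?_
  rw [vp_velocity hU, inner_add_left, inner_christoffel_eq]
  have hes : (e (U s)).2 = e.continuousLinearMapAt ℝ (U s).proj (U s).snd :=
    trivializationAt_snd _ hb
  have hsy : e.symmL ℝ (U s).proj (e (U s)).2 = (U s).snd := by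
    rw [hes, e.symmL_continuousLinearMapAt hb]
  have hm (v : E) : metricInChart I (U s).proj (U s).proj v (e (U s)).2 =
      inner ℝ (e.symmL ℝ (U s).proj v) (U s).snd := by
    rw [metricInChart_apply]
    exact congrArg (inner ℝ _) hsy
  have hm' (v : E) : metricInChart I (U s).proj (U s).proj (e (U s)).2 v =
      inner ℝ (e.symmL ℝ (U s).proj v) (U s).snd := by
    rw [metricInChart_comm, hm]
  rw [add_apply, hm, hm', hes]
  simp only [← he]
  ring

/-- The Leibniz rule for the covariant derivative along a curve. -/
lemma vp_velocity_smul {U : ℝ → TangentBundle I M} {φ : ℝ → ℝ} {s φ' : ℝ}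
    (hU : MDifferentiableAt 𝓘(ℝ, ℝ) I.tangent U s) (hφ : HasDerivAt φ φ' s)
    (hφU : MDifferentiableAt 𝓘(ℝ, ℝ) I.tangent
      (fun r => (⟨(U r).proj, φ r • (U r).snd⟩ : TangentBundle I M)) s) :
    vp (u := ⟨(U s).proj, φ s • (U s).snd⟩) (mfderiv 𝓘(ℝ, ℝ) I.tangent
      (fun r => (⟨(U r).proj, φ r • (U r).snd⟩ : TangentBundle I M)) s (1 : ℝ)) =
    φ' • (U s).snd + φ s • vp (u := U s) (mfderiv 𝓘(ℝ, ℝ) I.tangent U s (1 : ℝ)) := by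
  have hb := mem_baseSet_trivializationAt E (TangentSpace I) (U s).proj
  have hproj : MDifferentiableAt 𝓘(ℝ, ℝ) I (fun r => (U r).proj) s :=
    MDifferentiableAt.comp s
      ((Bundle.contMDiff_proj (n := 1) (TangentSpace I : M → Type _)).mdifferentiableAt
        one_ne_zero) hU
  have hy : DifferentiableAt ℝ
      (fun r => (trivializationAt E (TangentSpace I) (U s).proj (U r)).2) s := by
    rw [← mdifferentiableAt_iff_differentiableAt]
    exact MDifferentiableAt.comp (g := fun w : TangentBundle I M =>
      (trivializationAt E (TangentSpace I) (U s).proj w).2) s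
      ((contMDiffAt_trivializationAt_snd hb).mdifferentiableAt (by simp)) hU
  have hev : (fun r => (trivializationAt E (TangentSpace I) (U s).proj
      (⟨(U r).proj, φ r • (U r).snd⟩ : TangentBundle I M)).2) =ᶠ[𝓝 s]
      fun r => φ r • (trivializationAt E (TangentSpace I) (U s).proj (U r)).2 := by
    filter_upwards [hproj.continuousAt.eventually
      ((trivializationAt E (TangentSpace I) (U s).proj).open_baseSet.mem_nhds hb)] with r hr
    exact ((trivializationAt E (TangentSpace I) (U s).proj).linear ℝ hr).map_smul _ _
  have hd := ((hφ.smul hy.hasDerivAt).congr_of_eventuallyEq hev).deriv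
  have hsy : (trivializationAt E (TangentSpace I) (U s).proj).symmL ℝ (U s).proj
      (trivializationAt E (TangentSpace I) (U s).proj (U s)).2 = (U s).snd := by
    have := trivializationAt_snd (U s).snd hb
    refine (congrArg _ this).trans ?_
    rw [Trivialization.symmL_continuousLinearMapAt _ hb]
  rw [vp_velocity hφU, vp_velocity hU]
  dsimp only
  rw [hd, christoffel_smul, map_add, map_smul, map_smul, hsy]
  module

end Connection

section TorsionFree

variable {E : Type*} [NormedAddCommGroup E] [NormedSpace ℝ E] [FiniteDimensional ℝ E]
  {H : Type*} [TopologicalSpace H] {I : ModelWithCorners ℝ E H}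
  {M : Type*} [TopologicalSpace M] [ChartedSpace H M] [IsManifold I ∞ M]
  [RiemannianBundle (fun x : M => TangentSpace I x)]
  [IsContMDiffRiemannianBundle I ∞ E (fun x : M => TangentSpace I x)]

/-- Covariant derivatives of the velocities of a smooth family of curves commute. -/
lemma vp_velocity_comm {Γ : ℝ × unitInterval → M} {t₀ : unitInterval}
    (hΓ : ContMDiffAt (𝓘(ℝ, ℝ).prod (𝓡∂ 1)) I ∞ Γ (0, t₀)) :
    vp (u := ⟨Γ (0, t₀), mfderiv (𝓡∂ 1) I (fun t => Γ (0, t)) t₀ 1⟩)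
      (mfderiv 𝓘(ℝ, ℝ) I.tangent (fun s : ℝ =>
        (⟨Γ (s, t₀), mfderiv (𝓡∂ 1) I (fun t => Γ (s, t)) t₀ 1⟩ : TangentBundle I M)) 0 (1 : ℝ)) =
    vp (u := ⟨Γ (0, t₀), mfderiv 𝓘(ℝ, ℝ) I (fun s : ℝ => Γ (s, t₀)) 0 (1 : ℝ)⟩)
      (mfderiv (𝓡∂ 1) I.tangent (fun t : unitInterval =>
        (⟨Γ (0, t), mfderiv 𝓘(ℝ, ℝ) I (fun s : ℝ => Γ (s, t)) 0 (1 : ℝ)⟩ :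
          TangentBundle I M)) t₀ 1) := by
  set p := Γ (0, t₀) with hp
  set f : ℝ × unitInterval → E := fun q => extChartAt I p (Γ q)
  have hchart : ∀ x ∈ (chartAt H p).source, ContMDiffAt I 𝓘(ℝ, E) ∞ (extChartAt I p) x :=
    fun x hx => contMDiffAt_extChartAt' hx
  have hp' : p ∈ (chartAt H p).source := mem_chart_source H p
  have hf : ContMDiffAt (𝓘(ℝ, ℝ).prod (𝓡∂ 1)) 𝓘(ℝ, E) ∞ f (0, t₀) :=
    (hchart p hp').comp (0, t₀) hΓ
  have hsrc : ∀ᶠ q in 𝓝 ((0 : ℝ), t₀), Γ q ∈ (chartAt H p).source :=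
    hΓ.continuousAt.eventually ((chartAt H p).open_source.mem_nhds hp')
  have hev : ∀ᶠ q in 𝓝 ((0 : ℝ), t₀), ContMDiffAt (𝓘(ℝ, ℝ).prod (𝓡∂ 1)) I 1 Γ q :=
    (contMDiffAt_iff_contMDiffAt_nhds (by simp)).1 (hΓ.of_le ENat.LEInfty.out)
  have hts : Tendsto (fun s : ℝ => (s, t₀)) (𝓝 0) (𝓝 (0, t₀)) :=
    (Continuous.prodMk_left t₀).tendsto 0
  have htt : Tendsto (fun t : unitInterval => ((0 : ℝ), t)) (𝓝 t₀) (𝓝 (0, t₀)) :=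
    (Continuous.prodMk_right (0 : ℝ)).tendsto t₀
  have e1 : (fun s : ℝ => (trivializationAt E (TangentSpace I) p
      (⟨Γ (s, t₀), mfderiv (𝓡∂ 1) I (fun t => Γ (s, t)) t₀ 1⟩ : TangentBundle I M)).2) =ᶠ[𝓝 0]
      fun s => (mfderiv (𝓡∂ 1) 𝓘(ℝ, E) (fun t => f (s, t)) t₀ 1 : E) := by
    filter_upwards [hts.eventually hsrc, hts.eventually hev] with s h1 h2
    rw [trivializationAt_snd_eq_mfderiv _ h1]
    have h3 : MDifferentiableAt (𝓡∂ 1) I (fun t => Γ (s, t)) t₀ :=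
      (h2.comp t₀ (contMDiffAt_const.prodMk contMDiffAt_id)).mdifferentiableAt one_ne_zero
    exact (DFunLike.congr_fun (mfderiv_comp t₀ ((hchart _ h1).mdifferentiableAt (by simp)) h3)
      1).symm
  have e2 : (fun t : unitInterval => (trivializationAt E (TangentSpace I) p
      (⟨Γ (0, t), mfderiv 𝓘(ℝ, ℝ) I (fun s : ℝ => Γ (s, t)) 0 (1 : ℝ)⟩ :
        TangentBundle I M)).2) =ᶠ[𝓝 t₀] fun t => deriv (fun s : ℝ => f (s, t)) 0 := by
    filter_upwards [htt.eventually hsrc, htt.eventually hev] with t h1 h2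
    rw [trivializationAt_snd_eq_mfderiv _ h1]
    have h3 : MDifferentiableAt 𝓘(ℝ, ℝ) I (fun s : ℝ => Γ (s, t)) 0 :=
      (ContMDiffAt.comp (0 : ℝ) h2 (contMDiffAt_id.prodMk contMDiffAt_const)).mdifferentiableAt
        one_ne_zero
    exact (hasDerivAt_comp_of_mdifferentiableAt ((hchart _ h1).mdifferentiableAt (by simp))
      h3).deriv.symm
  have hU1 : MDifferentiableAt 𝓘(ℝ, ℝ) I.tangent (fun s : ℝ =>
      (⟨Γ (s, t₀), mfderiv (𝓡∂ 1) I (fun t => Γ (s, t)) t₀ 1⟩ : TangentBundle I M)) 0 :=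
    (ContMDiffAt.comp (0 : ℝ) (contMDiffAt_snd_velocity hΓ)
      (contMDiffAt_id.prodMk contMDiffAt_const)).mdifferentiableAt (by simp)
  have hU2 := (contMDiffAt_fst_velocity hΓ).mdifferentiableAt (by simp)
  have hcomm := deriv_mfderiv_comm hf
  rw [vp_velocity hU1, vp_mfderiv hU2 1, christoffel_comm]
  refine congrArg₂ (· + ·) (congrArg _ ?_) rfl
  refine Eq.trans ?_ (hcomm.trans ?_)
  · exact e1.deriv_eq
  · exact (DFunLike.congr_fun e2.mfderiv_eq 1).symm

end TorsionFree

section Variations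

variable {E : Type*} [NormedAddCommGroup E] [NormedSpace ℝ E]
  {H : Type*} [TopologicalSpace H] {I : ModelWithCorners ℝ E H}
  {M : Type*} [TopologicalSpace M] [ChartedSpace H M]

/-- `Γ` is a variation of the curve `c`, smooth for small parameters, with velocity `k`. -/
def IsVariation (c : unitInterval → M) (k : ∀ t, TangentSpace I (c t))
    (Γ : ℝ × unitInterval → M) : Prop :=
  (∀ t : unitInterval, ∀ᶠ q in 𝓝 ((0 : ℝ), t),
    ContMDiffAt (𝓘(ℝ, ℝ).prod (𝓡∂ 1)) I ∞ Γ q) ∧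
  ∀ t : unitInterval, (⟨Γ (0, t), mfderiv 𝓘(ℝ, ℝ) I (fun s : ℝ => Γ (s, t)) 0 (1 : ℝ)⟩ :
    TangentBundle I M) = ⟨c t, k t⟩

lemma IsVariation.contMDiffAt_left {c : unitInterval → M} {k : ∀ t, TangentSpace I (c t)}
    {Γ : ℝ × unitInterval → M} (hΓ : IsVariation c k Γ) (t : unitInterval) :
    ContMDiffAt 𝓘(ℝ, ℝ) I ∞ (fun s : ℝ => Γ (s, t)) 0 :=
  ContMDiffAt.comp (0 : ℝ) (hΓ.1 t).self_of_nhds (contMDiffAt_id.prodMk contMDiffAt_const)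

lemma IsVariation.apply_zero {c : unitInterval → M} {k : ∀ t, TangentSpace I (c t)}
    {Γ : ℝ × unitInterval → M} (hΓ : IsVariation c k Γ) (t : unitInterval) : Γ (0, t) = c t :=
  congrArg TotalSpace.proj (hΓ.2 t)

lemma velocity_congr {x y : ℝ → M} (h : x =ᶠ[𝓝 0] y) :
    (⟨x 0, mfderiv 𝓘(ℝ, ℝ) I x 0 (1 : ℝ)⟩ : TangentBundle I M) =
      ⟨y 0, mfderiv 𝓘(ℝ, ℝ) I y 0 (1 : ℝ)⟩ :=
  TotalSpace.ext h.self_of_nhds (heq_of_eq (DFunLike.congr_fun h.mfderiv_eq (1 : ℝ)))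

lemma IsSmoothPath.contMDiffAt {γ : ℝ → Imm I M} (hγ : IsSmoothPath γ) (t : unitInterval) :
    ContMDiffAt (𝓘(ℝ, ℝ).prod (𝓡∂ 1)) I ∞ (fun q : ℝ × unitInterval => γ q.1 q.2) (0, t) := by
  obtain ⟨ε, hε, h⟩ := hγ
  refine h.contMDiffAt ((isOpen_Ioo.prod isOpen_univ).mem_nhds ⟨⟨?_, ?_⟩, trivial⟩)
  · exact neg_lt_zero.2 hε
  · exact hε

variable [IsManifold I ∞ M]

lemma Represents.apply_zero {γ : ℝ → Imm I M} {c : Imm I M} {h : TImm c}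
    (hγ : Represents γ c h) : γ 0 = c := by
  have : (γ 0).toFun = c.toFun := funext fun t => congrArg TotalSpace.proj (hγ.2 t)
  cases hc : γ 0
  cases c
  simp_all

/-- Points of `TM` are equal if they have the same base point and the same coordinates. -/
lemma tangentBundle_ext {p : M} {u v : TangentBundle I M} (hu : u.proj ∈ (chartAt H p).source)
    (h₁ : u.proj = v.proj)
    (h₂ : (trivializationAt E (TangentSpace I) p u).2 =
      (trivializationAt E (TangentSpace I) p v).2) : u = v := by
  have hu' : u ∈ (trivializationAt E (TangentSpace I) p).source :=
    (trivializationAt E (TangentSpace I) p).mem_source.2 hu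
  have hv' : v ∈ (trivializationAt E (TangentSpace I) p).source :=
    (trivializationAt E (TangentSpace I) p).mem_source.2 (h₁ ▸ hu)
  refine (trivializationAt E (TangentSpace I) p).injOn hu' hv' (Prod.ext ?_ h₂)
  exact ((trivializationAt E (TangentSpace I) p).coe_fst hu').trans
    (h₁.trans ((trivializationAt E (TangentSpace I) p).coe_fst hv').symm)

/-- The velocity of a curve, in coordinates. -/
lemma trivializationAt_velocity {x : ℝ → M} {p : M} (hx : MDifferentiableAt 𝓘(ℝ, ℝ) I x 0)
    (hp : x 0 ∈ (chartAt H p).source) :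
    (trivializationAt E (TangentSpace I) p
      (⟨x 0, mfderiv 𝓘(ℝ, ℝ) I x 0 (1 : ℝ)⟩ : TangentBundle I M)).2 =
      deriv (fun s => extChartAt I p (x s)) 0 := by
  rw [trivializationAt_snd_eq_mfderiv _ hp]
  exact (hasDerivAt_comp_of_mdifferentiableAt
    ((contMDiffAt_extChartAt' (n := 1) hp).mdifferentiableAt one_ne_zero) hx).deriv.symm

/-- A variation can be modified in a chart, to add to its velocity a field supported there. -/
lemma IsVariation.exists_add [I.Boundaryless] {c : unitInterval → M}
    (hc : ContMDiff (𝓡∂ 1) I ∞ c)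
    {k h : ∀ t, TangentSpace I (c t)} {Γ : ℝ × unitInterval → M} (hΓ : IsVariation c k Γ)
    (hh : ContMDiff (𝓡∂ 1) I.tangent ∞ (fun t => (⟨c t, h t⟩ : TangentBundle I M)))
    {ρ : unitInterval → ℝ} (hρ : ContMDiff (𝓡∂ 1) 𝓘(ℝ, ℝ) ∞ ρ) {p : M}
    (hp : ∀ t ∈ tsupport ρ, c t ∈ (chartAt H p).source) :
    ∃ Γ', IsVariation c (fun t => k t + ρ t • h t) Γ' := by
  classical
  set e := trivializationAt E (TangentSpace I) p with he
  set w : unitInterval → E := fun t => (e (⟨c t, h t⟩ : TangentBundle I M)).2 with hw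
  set Y : ℝ × unitInterval → E := fun q => extChartAt I p (Γ q) + (q.1 * ρ q.2) • w q.2 with hY
  set F : ℝ × unitInterval → M := fun q => (extChartAt I p).symm (Y q) with hF
  have hY0 (t : unitInterval) : Y (0, t) = extChartAt I p (Γ (0, t)) := by simp [hY]
  have hYs : ∀ q : ℝ × unitInterval, ContMDiffAt (𝓘(ℝ, ℝ).prod (𝓡∂ 1)) I ∞ Γ q →
      Γ q ∈ (chartAt H p).source → c q.2 ∈ (chartAt H p).source →
      ContMDiffAt (𝓘(ℝ, ℝ).prod (𝓡∂ 1)) 𝓘(ℝ, E) ∞ Y q := by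
    intro q h1 h2 h3
    have hws : ContMDiffAt (𝓡∂ 1) 𝓘(ℝ, E) ∞ w q.2 :=
      ContMDiffAt.comp (g := fun u : TangentBundle I M => (e u).2) q.2
        (contMDiffAt_trivializationAt_snd h3) (hh q.2)
    refine ((contMDiffAt_extChartAt' h2).comp q h1).add ?_
    exact (contMDiffAt_fst.mul ((hρ q.2).comp q contMDiffAt_snd)).smul
      (hws.comp q contMDiffAt_snd)
  have hnear : ∀ t ∈ tsupport ρ, ∀ᶠ q in 𝓝 ((0 : ℝ), t),
      ContMDiffAt (𝓘(ℝ, ℝ).prod (𝓡∂ 1)) I ∞ Γ q ∧ Γ q ∈ (chartAt H p).source ∧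
      ContMDiffAt (𝓘(ℝ, ℝ).prod (𝓡∂ 1)) 𝓘(ℝ, E) ∞ Y q ∧ Y q ∈ (extChartAt I p).target := by
    intro t ht
    have hs := (hΓ.1 t).self_of_nhds
    have h0 : Γ (0, t) ∈ (chartAt H p).source := by rw [hΓ.apply_zero]; exact hp t ht
    have hYt : Y (0, t) ∈ (extChartAt I p).target := by
      rw [hY0]
      exact (extChartAt I p).map_source (by rwa [extChartAt_source])
    have a1 := hs.continuousAt.eventually ((chartAt H p).open_source.mem_nhds h0)
    have a2 : ∀ᶠ q in 𝓝 ((0 : ℝ), t), c q.2 ∈ (chartAt H p).source :=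
      (hc.continuous.comp continuous_snd).continuousAt.eventually
        ((chartAt H p).open_source.mem_nhds (hp t ht))
    have a3 := (hYs (0, t) hs h0 (hp t ht)).continuousAt.eventually
      ((isOpen_extChartAt_target p).mem_nhds hYt)
    filter_upwards [hΓ.1 t, a1, a2, a3] with q h1 h2 h3 h4
    exact ⟨h1, h2, hYs q h1 h2 h3, h4⟩
  refine ⟨fun q => if q.2 ∈ tsupport ρ then F q else Γ q, fun t => ?_, fun t => ?_⟩
  · by_cases ht : t ∈ tsupport ρ
    · have hev := hnear t ht
      filter_upwards [hev, hev.eventually_nhds] with q hq hqn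
      have hFq : ContMDiffAt (𝓘(ℝ, ℝ).prod (𝓡∂ 1)) I ∞ F q :=
        ((contMDiffOn_extChartAt_symm p).contMDiffAt
          ((isOpen_extChartAt_target p).mem_nhds hq.2.2.2)).comp q hq.2.2.1
      refine hFq.congr_of_eventuallyEq ?_
      filter_upwards [hqn] with r hr
      split_ifs with hrs
      · rfl
      · have : ρ r.2 = 0 := image_eq_zero_of_notMem_tsupport hrs
        simp only [hF, hY, this, mul_zero, zero_smul, add_zero]
        exact ((extChartAt I p).left_inv (by rw [extChartAt_source]; exact hr.2.1)).symm
    · have hopen : ∀ᶠ q in 𝓝 ((0 : ℝ), t), q.2 ∉ tsupport ρ :=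
        (continuous_snd.tendsto ((0 : ℝ), t)).eventually
          ((isClosed_tsupport ρ).isOpen_compl.mem_nhds ht)
      filter_upwards [hΓ.1 t, hopen.eventually_nhds] with q hq hqn
      refine hq.congr_of_eventuallyEq ?_
      filter_upwards [hqn] with r hr
      exact if_neg hr
  · by_cases ht : t ∈ tsupport ρ
    · have hcongr : (fun s : ℝ => (fun q : ℝ × unitInterval =>
          if q.2 ∈ tsupport ρ then F q else Γ q) (s, t)) =ᶠ[𝓝 0] fun s : ℝ => F (s, t) :=
        Eventually.of_forall fun s => if_pos ht
      refine (velocity_congr (I := I) hcongr).trans ?_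
      have hct := hp t ht
      obtain ⟨h1, h2, h3, h4⟩ := (hnear t ht).self_of_nhds
      have hF0 : F (0, t) = c t := by
        rw [← hΓ.apply_zero t]
        simp only [hF, hY0]
        exact (extChartAt I p).left_inv (by rwa [extChartAt_source])
      have hFs : ContMDiffAt 𝓘(ℝ, ℝ) I ∞ (fun s : ℝ => F (s, t)) 0 :=
        ContMDiffAt.comp (g := F) (0 : ℝ) (((contMDiffOn_extChartAt_symm p).contMDiffAt
          ((isOpen_extChartAt_target p).mem_nhds h4)).comp (0, t) h3)
          (contMDiffAt_id.prodMk contMDiffAt_const)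
      have hF0' : F (0, t) ∈ (chartAt H p).source := by rwa [hF0]
      refine tangentBundle_ext (p := p) hF0' hF0 ?_
      refine (trivializationAt_velocity (x := fun s : ℝ => F (s, t))
        (hFs.mdifferentiableAt (by simp)) hF0').trans ?_
      have hyk := trivializationAt_velocity (x := fun s : ℝ => Γ (s, t))
        ((hΓ.contMDiffAt_left t).mdifferentiableAt (by simp)) h2
      rw [hΓ.2 t] at hyk
      have hev : (fun s : ℝ => extChartAt I p (F (s, t))) =ᶠ[𝓝 0] fun s => Y (s, t) := by
        filter_upwards [((Continuous.prodMk_left t).tendsto (0 : ℝ)).eventually (hnear t ht)]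
          with s hs
        exact (extChartAt I p).right_inv hs.2.2.2
      have hd : DifferentiableAt ℝ (fun s : ℝ => extChartAt I p (Γ (s, t))) 0 :=
        (((contMDiffAt_extChartAt' h2).comp (0 : ℝ)
          (hΓ.contMDiffAt_left t)).mdifferentiableAt (by simp)).differentiableAt
      have hd2 : HasDerivAt (fun s : ℝ => (s * ρ t) • w t) (ρ t • w t) 0 := by
        simpa using ((hasDerivAt_id (0 : ℝ)).mul_const (ρ t)).smul_const (w t)
      refine hev.deriv_eq.trans ((hd.hasDerivAt.add hd2).deriv.trans ?_)
      rw [← hyk, trivializationAt_snd _ hct, trivializationAt_snd _ hct, map_add, map_smul]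
      exact congrArg (fun z => _ + ρ t • z) (trivializationAt_snd _ hct)
    · have hcongr : (fun s : ℝ => (fun q : ℝ × unitInterval =>
          if q.2 ∈ tsupport ρ then F q else Γ q) (s, t)) =ᶠ[𝓝 0] fun s : ℝ => Γ (s, t) :=
        Eventually.of_forall fun s => if_neg ht
      refine (velocity_congr (I := I) hcongr).trans ?_
      rw [hΓ.2 t]
      dsimp only
      rw [image_eq_zero_of_notMem_tsupport ht, zero_smul, add_zero]

/-- Each smooth vector field along a smooth curve is the velocity of a variation. -/
lemma exists_isVariation [I.Boundaryless] {c : unitInterval → M} (hc : ContMDiff (𝓡∂ 1) I ∞ c)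
    {h : ∀ t, TangentSpace I (c t)}
    (hh : ContMDiff (𝓡∂ 1) I.tangent ∞ (fun t => (⟨c t, h t⟩ : TangentBundle I M))) :
    ∃ Γ, IsVariation c h Γ := by
  classical
  obtain ⟨T, hT⟩ := CompactSpace.elim_nhds_subcover
    (fun t : unitInterval => c ⁻¹' (chartAt H (c t)).source)
    fun t => hc.continuous.continuousAt.preimage_mem_nhds
      ((chartAt H (c t)).open_source.mem_nhds (mem_chart_source H (c t)))
  obtain ⟨ρ, hρ⟩ := SmoothPartitionOfUnity.exists_isSubordinate (𝓡∂ 1)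
    (isClosed_univ (X := unitInterval)) (fun i : T => c ⁻¹' (chartAt H (c i)).source)
    (fun i => (chartAt H (c i)).open_source.preimage hc.continuous)
    (fun t _ => by
      obtain ⟨i, hi, hti⟩ := Set.mem_iUnion₂.1 (hT.ge (Set.mem_univ t))
      exact Set.mem_iUnion.2 ⟨⟨i, hi⟩, hti⟩)
  have key : ∀ S : Finset T, ∃ Γ, IsVariation c (fun t => (∑ i ∈ S, ρ i t) • h t) Γ := by
    intro S
    induction S using Finset.induction_on with
    | empty =>
      refine ⟨fun q => c q.2, fun t => Eventually.of_forall fun q =>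
        (hc q.2).comp q contMDiffAt_snd, fun t => ?_⟩
      simp only [Finset.sum_empty, zero_smul, mfderiv_const]
      rfl
    | insert i S hi ih =>
      obtain ⟨Γ, hΓ⟩ := ih
      obtain ⟨Γ', hΓ'⟩ := hΓ.exists_add hc hh (ρ i).contMDiff (p := c i) (fun t ht => hρ i ht)
      refine ⟨Γ', ?_⟩
      convert hΓ' using 2 with t
      rw [Finset.sum_insert hi, add_smul, add_comm]
  obtain ⟨Γ, hΓ⟩ := key Finset.univ
  refine ⟨Γ, ?_⟩
  convert hΓ using 2 with t
  have := ρ.sum_eq_one (Set.mem_univ t)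
  rw [finsum_eq_sum_of_fintype] at this
  rw [this, one_smul]

/-- Each tangent vector to the space of immersions is the velocity of a path of immersions. -/
lemma exists_represents [I.Boundaryless] (c : Imm I M) (h : TImm c) :
    ∃ γ : ℝ → Imm I M, Represents γ c h := by
  classical
  obtain ⟨Γ, hΓ, hv⟩ := exists_isVariation c.smooth h.smooth
  have hΓ0 : (fun t => Γ (0, t)) = c := funext fun t => congrArg TotalSpace.proj (hv t)
  have himm : ∀ t : unitInterval, ∀ᶠ q in 𝓝 ((0 : ℝ), t),
      mfderiv (𝓡∂ 1) I (fun t => Γ (q.1, t)) q.2 1 ≠ 0 := by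
    intro t
    have hs := (contMDiffAt_snd_velocity (hΓ t).self_of_nhds)
    set e := trivializationAt E (TangentSpace I) (Γ (0, t)) with he
    have hb : Γ (0, t) ∈ e.baseSet := mem_baseSet_trivializationAt E (TangentSpace I) _
    have hcont := ((contMDiffAt_trivializationAt_snd (I := I) hb).comp ((0 : ℝ), t) hs).continuousAt
    have hne : (e (⟨Γ (0, t), mfderiv (𝓡∂ 1) I (fun t => Γ (0, t)) t 1⟩ :
        TangentBundle I M)).2 ≠ 0 := by
      rw [trivializationAt_snd _ hb]
      intro h0
      have h1 := congrArg (e.symmL ℝ (Γ (0, t))) h0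
      rw [e.symmL_continuousLinearMapAt hb, map_zero] at h1
      rw [hΓ0] at h1
      exact c.immersive t h1
    filter_upwards [hcont.eventually_ne hne,
      (hΓ t).self_of_nhds.continuousAt.eventually (e.open_baseSet.mem_nhds hb)] with q hq hqb h0
    refine hq ?_
    simp only [Function.comp_apply, h0]
    rw [trivializationAt_snd _ hqb, map_zero]
  have hall : ∀ᶠ s in 𝓝 (0 : ℝ), ∀ t : unitInterval,
      ContMDiffAt (𝓘(ℝ, ℝ).prod (𝓡∂ 1)) I ∞ Γ (s, t) ∧
      mfderiv (𝓡∂ 1) I (fun t => Γ (s, t)) t 1 ≠ 0 := by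
    have := isCompact_univ.eventually_forall_of_forall_eventually (x₀ := (0 : ℝ))
      (K := (Set.univ : Set unitInterval))
      (P := fun s t => ContMDiffAt (𝓘(ℝ, ℝ).prod (𝓡∂ 1)) I ∞ Γ (s, t) ∧
        mfderiv (𝓡∂ 1) I (fun t => Γ (s, t)) t 1 ≠ 0)
      (fun t _ => (hΓ t).and (himm t))
    simpa using this
  let γ : ℝ → Imm I M := fun s =>
    if hs : ∀ t : unitInterval, ContMDiffAt (𝓘(ℝ, ℝ).prod (𝓡∂ 1)) I ∞ Γ (s, t) ∧
        mfderiv (𝓡∂ 1) I (fun t => Γ (s, t)) t 1 ≠ 0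
    then ⟨fun t => Γ (s, t), fun t => (hs t).1.comp t (contMDiffAt_const.prodMk contMDiffAt_id),
      fun t => (hs t).2⟩
    else c
  have hγ : ∀ᶠ s in 𝓝 (0 : ℝ), ∀ t, γ s t = Γ (s, t) := by
    filter_upwards [hall] with s hs t
    simp only [γ, dif_pos hs]
  obtain ⟨ε, hε, hball⟩ := Metric.eventually_nhds_iff_ball.1 (hall.and hγ)
  refine ⟨γ, ⟨ε, hε, ?_⟩, fun t => ?_⟩
  · rintro ⟨s, t⟩ ⟨hs, -⟩
    have hmem (s : ℝ) (hs : s ∈ Set.Ioo (-ε) ε) : s ∈ Metric.ball (0 : ℝ) ε := by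
      simpa [Real.ball_eq_Ioo] using hs
    exact ((hball s (hmem s hs)).1 t).1.contMDiffWithinAt.congr
      (fun q hq => (hball q.1 (hmem _ hq.1)).2 q.2) ((hball s (hmem s hs)).2 t)
  · have h1 : (fun s : ℝ => γ s t) =ᶠ[𝓝 0] fun s => Γ (s, t) := hγ.mono fun s hs => hs t
    exact (velocity_congr h1).trans (hv t)

end Variations

section SquareRootVelocity

variable {E : Type*} [NormedAddCommGroup E] [NormedSpace ℝ E]
  {H : Type*} [TopologicalSpace H] {I : ModelWithCorners ℝ E H}
  {M : Type*} [TopologicalSpace M] [ChartedSpace H M] [IsManifold I ∞ M]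
  [RiemannianBundle (fun x : M => TangentSpace I x)]
  [IsContMDiffRiemannianBundle I ∞ E (fun x : M => TangentSpace I x)]

/-- The map `v ↦ v / √‖v‖` is smooth away from the zero section of `TM`. -/
lemma contMDiffAt_inv_sqrt_norm_smul {EX : Type*} [NormedAddCommGroup EX] [NormedSpace ℝ EX]
    {HX : Type*} [TopologicalSpace HX] {K : ModelWithCorners ℝ EX HX}
    {X : Type*} [TopologicalSpace X] [ChartedSpace HX X]
    {b : X → M} {v : ∀ x, TangentSpace I (b x)} {x₀ : X}
    (hv : ContMDiffAt K I.tangent ∞ (fun x => (⟨b x, v x⟩ : TangentBundle I M)) x₀)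
    (hne : v x₀ ≠ 0) :
    ContMDiffAt K I.tangent ∞
      (fun x => (⟨b x, (√‖v x‖)⁻¹ • v x⟩ : TangentBundle I M)) x₀ := by
  have hi : ContMDiffAt K 𝓘(ℝ, ℝ) ∞ (fun x => inner ℝ (v x) (v x)) x₀ :=
    ContMDiffAt.inner_bundle hv hv
  have ha : ContMDiffAt K 𝓘(ℝ, ℝ) ∞ (fun x => (√‖v x‖)⁻¹) x₀ := by
    have hne' : inner ℝ (v x₀) (v x₀) ≠ 0 := inner_self_ne_zero.2 hne
    have hg : ContDiffAt ℝ ∞ (fun x : ℝ => (√(√x))⁻¹) (inner ℝ (v x₀) (v x₀)) := by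
      have h1 := Real.contDiffAt_sqrt (n := ∞) hne'
      have h0 : 0 < inner ℝ (v x₀) (v x₀) := lt_of_le_of_ne real_inner_self_nonneg hne'.symm
      exact (h1.sqrt (Real.sqrt_ne_zero'.2 h0)).inv (Real.sqrt_ne_zero'.2 (Real.sqrt_pos.2 h0))
    refine (hg.contMDiffAt.comp x₀ hi).congr_of_eventuallyEq (Eventually.of_forall fun x => ?_)
    simp only [Function.comp_apply, norm_eq_sqrt_real_inner]
  have hvt := Bundle.contMDiffAt_totalSpace.1 hv
  rw [Bundle.contMDiffAt_totalSpace]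
  refine ⟨hvt.1, (ha.smul hvt.2).congr_of_eventuallyEq ?_⟩
  have hb : ∀ᶠ x in 𝓝 x₀, b x ∈ (trivializationAt E (TangentSpace I) (b x₀)).baseSet :=
    hvt.1.continuousAt.eventually
      ((trivializationAt E (TangentSpace I) (b x₀)).open_baseSet.mem_nhds
        (mem_baseSet_trivializationAt E (TangentSpace I) (b x₀)))
  filter_upwards [hb] with x hx
  exact ((trivializationAt E (TangentSpace I) (b x₀)).linear ℝ hx).map_smul _ _

lemma IsSmoothPath.contMDiffAt_srvf {γ : ℝ → Imm I M} (hγ : IsSmoothPath γ) (t : unitInterval) :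
    ContMDiffAt (𝓘(ℝ, ℝ).prod (𝓡∂ 1)) I.tangent ∞
      (fun q : ℝ × unitInterval => (srvf (γ q.1)).curve q.2) (0, t) :=
  contMDiffAt_inv_sqrt_norm_smul (contMDiffAt_snd_velocity (hγ.contMDiffAt t))
    ((γ 0).immersive t)

lemma smul_add_smul_eq_sqrt_smul {W : Type*} [AddCommGroup W] [Module ℝ W] {a : ℝ} (ha : 0 < a)
    (x : ℝ) (X V : W) :
    (-(2 * (a * x) / (2 * a) / (2 * √a)) / √a ^ 2) • V + (√a)⁻¹ • a • X =
      √a • (X - (1 / 2 : ℝ) • (a⁻¹ * x) • a⁻¹ • V) := by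
  have hb : 0 < √a := Real.sqrt_pos.2 ha
  have hab : a = √a ^ 2 := (Real.sq_sqrt ha.le).symm
  generalize √a = b at *
  subst hab
  match_scalars <;> field_simp

variable [FiniteDimensional ℝ E]

/-- The differential of the square root velocity function, through its horizontal and vertical
projections. -/
lemma Represents.exists_srvf_velocity {γ : ℝ → Imm I M} {c : Imm I M} {h : TImm c}
    (hγ : Represents γ c h) (t : unitInterval) :
    ∃ ξ : TangentSpace I.tangent ((srvf c).curve t),
      (⟨(srvf (γ 0)).curve t,
        mfderiv 𝓘(ℝ, ℝ) I.tangent (fun s : ℝ => (srvf (γ s)).curve t) 0 (1 : ℝ)⟩ :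
        TangentBundle I.tangent (TangentBundle I M)) = ⟨(srvf c).curve t, ξ⟩ ∧
      hp ξ = h t ∧
      vp ξ = √‖c.vel t‖ • (covArc h t - (1 / 2 : ℝ) • covArcT h t) := by
  obtain rfl := hγ.apply_zero
  have hd : MDifferentiableAt 𝓘(ℝ, ℝ) I.tangent (fun s : ℝ => (srvf (γ s)).curve t) 0 :=
    (ContMDiffAt.comp (0 : ℝ) (hγ.1.contMDiffAt_srvf t)
      (contMDiffAt_id.prodMk contMDiffAt_const)).mdifferentiableAt (by simp)
  refine ⟨_, rfl, ?_, ?_⟩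
  · refine (hp_mfderiv hd (1 : ℝ)).trans ?_
    exact TotalSpace.mk_inj.1 (hγ.2 t)
  · have hΓ := hγ.1.contMDiffAt t
    set U : ℝ → TangentBundle I M := fun s => ⟨γ s t, (γ s).vel t⟩
    have hU : MDifferentiableAt 𝓘(ℝ, ℝ) I.tangent U 0 :=
      (ContMDiffAt.comp (0 : ℝ) (contMDiffAt_snd_velocity hΓ)
        (contMDiffAt_id.prodMk contMDiffAt_const)).mdifferentiableAt (by simp)
    have ha : 0 < ‖(γ 0).vel t‖ := norm_pos_iff.2 ((γ 0).immersive t)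
    set a := ‖(γ 0).vel t‖ with hadef
    have hcov : vp (u := U 0) (mfderiv 𝓘(ℝ, ℝ) I.tangent U 0 (1 : ℝ)) = a • covArc h t := by
      have hcongr : ∀ A B : unitInterval → TangentBundle I M, A = B →
          (vp (u := A t) (mfderiv (𝓡∂ 1) I.tangent A t 1) : E) =
            vp (u := B t) (mfderiv (𝓡∂ 1) I.tangent B t 1) := by
        rintro A _ rfl
        rfl
      have h1 := (vp_velocity_comm hΓ).trans (hcongr _ h.curve (funext hγ.2))
      exact h1.trans (smul_inv_smul₀ ha.ne' _).symm
    have hn := hasDerivAt_inner_self hU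
    rw [hcov] at hn
    have hroot : √(inner ℝ (U 0).snd (U 0).snd) = a := (norm_eq_sqrt_real_inner _).symm
    have hpos : 0 < inner ℝ (U 0).snd (U 0).snd := real_inner_self_pos.2 ((γ 0).immersive t)
    have hφ := ((hn.sqrt hpos.ne').sqrt (by rw [hroot]; exact ha.ne')).inv
      (by rw [hroot]; exact (Real.sqrt_pos.2 ha).ne')
    rw [hroot] at hφ
    have hfun : (fun r => √√(inner ℝ (U r).snd (U r).snd))⁻¹ = fun r => (√‖(U r).snd‖)⁻¹ := by
      funext r
      simp only [Pi.inv_apply, norm_eq_sqrt_real_inner]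
    rw [hfun] at hφ
    have hvp := vp_velocity_smul hU hφ hd
    refine hvp.trans ?_
    rw [hcov]
    have hU0 : ‖(U 0).snd‖ = a := rfl
    have hV : (U 0).snd = (γ 0).vel t := rfl
    unfold covArcT
    rw [hU0, hV, real_inner_smul_left, real_inner_smul_right]
    exact smul_add_smul_eq_sqrt_smul ha _ _ _

/-- The projections of the differential of the square root velocity function. -/
lemma IsTangentSRVF.hp_eq_vp_eq {c : Imm I M} {h : TImm c} {ξ : TTImm (srvf c)}
    (hξ : IsTangentSRVF c h ξ) (t : unitInterval) :
    hp (ξ t) = h t ∧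
      vp (ξ t) = √‖c.vel t‖ • (covArc h t - (1 / 2 : ℝ) • covArcT h t) := by
  obtain ⟨⟨γ, hγ⟩, hall⟩ := hξ
  obtain ⟨ξ₀, h₀, h₁, h₂⟩ := hγ.exists_srvf_velocity t
  have : ξ t = ξ₀ := TotalSpace.mk_inj.1 ((hall γ hγ t).symm.trans h₀)
  rw [this]
  exact ⟨h₁, h₂⟩

lemma existsUnique_isTangentSRVF [I.Boundaryless] (c : Imm I M) (h : TImm c) :
    ∃! ξ : TTImm (srvf c), IsTangentSRVF c h ξ := by
  obtain ⟨γ, hγ⟩ := exists_represents c h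
  choose ξ₀ h₀ h₁ h₂ using hγ.exists_srvf_velocity
  have hsmooth : ContMDiff (𝓡∂ 1) I.tangent.tangent ∞ (fun t =>
      (⟨(srvf c).curve t, ξ₀ t⟩ : TangentBundle I.tangent (TangentBundle I M))) := by
    intro t
    refine (contMDiffAt_fst_velocity (hγ.1.contMDiffAt_srvf t)).congr_of_eventuallyEq
      (Eventually.of_forall fun t => (h₀ t).symm)
  have hξ : IsTangentSRVF c h ⟨ξ₀, hsmooth⟩ := by
    refine ⟨⟨γ, hγ⟩, fun γ' hγ' t => ?_⟩
    obtain ⟨ξ', h₀', h₁', h₂'⟩ := hγ'.exists_srvf_velocity t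
    rw [h₀', eq_of_hp_eq_of_vp_eq (h₁'.trans (h₁ t).symm) (h₂'.trans (h₂ t).symm)]
  refine ⟨_, hξ, fun η hη => ?_⟩
  have heq : η.toFun = ξ₀ := funext fun t =>
    eq_of_hp_eq_of_vp_eq ((hη.hp_eq_vp_eq t).1.trans (h₁ t).symm)
      ((hη.hp_eq_vp_eq t).2.trans (h₂ t).symm)
  cases η
  cases heq
  rfl

/-- The polarized form of `‖x - ⟨x, v⟩ v / 2‖² = ‖x - ⟨x, v⟩ v‖² + ‖⟨x, v⟩ v‖² / 4` for unit
vectors `v`. -/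
lemma inner_sub_half_proj {V : Type*} [NormedAddCommGroup V] [InnerProductSpace ℝ V]
    {x y v : V} (hv : inner ℝ v v = (1 : ℝ)) :
    inner ℝ (x - inner ℝ x v • v) (y - inner ℝ y v • v) +
        1 / 4 * inner ℝ (inner ℝ x v • v) (inner ℝ y v • v) =
      inner ℝ (x - (1 / 2 : ℝ) • inner ℝ x v • v) (y - (1 / 2 : ℝ) • inner ℝ y v • v) := by
  simp only [inner_sub_left, inner_sub_right, real_inner_smul_left, real_inner_smul_right, hv,
    real_inner_comm v y]
  rw [real_inner_comm y v]
  ring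

lemma IsTangentSRVF.G_eq_GTilde {c : Imm I M} {h k : TImm c} {ξ η : TTImm (srvf c)}
    (hξ : IsTangentSRVF c h ξ) (hη : IsTangentSRVF c k η) : G c h k = GTilde (srvf c) ξ η := by
  unfold G GTilde
  rw [(hξ.hp_eq_vp_eq 0).1, (hη.hp_eq_vp_eq 0).1]
  refine congrArg₂ (· + ·) rfl (integral_congr_ae (Eventually.of_forall fun t => ?_))
  have ha : 0 < ‖c.vel t‖ := norm_pos_iff.2 (c.immersive t)
  have hv : inner ℝ (‖c.vel t‖⁻¹ • c.vel t) (‖c.vel t‖⁻¹ • c.vel t) = (1 : ℝ) := by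
    rw [real_inner_smul_left, real_inner_smul_right, real_inner_self_eq_norm_sq]
    field_simp
  have key := inner_sub_half_proj (x := covArc h t) (y := covArc k t) hv
  dsimp only
  rw [(hξ.hp_eq_vp_eq t).2, (hη.hp_eq_vp_eq t).2]
  refine Eq.trans (congrArg (· * ‖c.vel t‖) key) ?_
  refine Eq.trans ?_ ((real_inner_smul_left _ _ _).trans
    (congrArg _ (real_inner_smul_right _ _ _))).symm
  rw [← mul_assoc, Real.mul_self_sqrt ha.le, mul_comm]
  rfl

end SquareRootVelocity

end SRV

end

theorem proposition1 {E : Type*} [NormedAddCommGroup E] [NormedSpace ℝ E] [FiniteDimensional ℝ E]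
    {H : Type*} [TopologicalSpace H] {I : ModelWithCorners ℝ E H} [I.Boundaryless]
    {M : Type*} [TopologicalSpace M] [ChartedSpace H M] [IsManifold I ∞ M]
    [RiemannianBundle (fun x : M => TangentSpace I x)]
    [IsContMDiffRiemannianBundle I ∞ E (fun x : M => TangentSpace I x)]
    (c : SRV.Imm I M) :
    (∀ h : SRV.TImm c, ∃! ξ : SRV.TTImm (SRV.srvf c), SRV.IsTangentSRVF c h ξ) ∧
    ∀ (h k : SRV.TImm c) (ξ η : SRV.TTImm (SRV.srvf c)),
      SRV.IsTangentSRVF c h ξ → SRV.IsTangentSRVF c k η →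
      SRV.G c h k = SRV.GTilde (SRV.srvf c) ξ η :=
  ⟨SRV.existsUnique_isTangentSRVF c, fun _ _ _ _ hξ hη => hξ.G_eq_GTilde hη⟩
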